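/- Let $q_1,q_2\in\mathbb H(\mathbb Z)$ be quaternions with integer components, with $N(x+yi+zj+tk)=x^2+y^2+z^2+t^2$. Assume that $N(q_1)$ and $N(q_2)$ are odd and that neither $q_1$ nor $q_2$ is right-divisible in $\mathbb H(\mathbb Z)$ by a quaternion $\alpha+\beta i$ with $\alpha,\beta\in\mathbb Z$ and $\alpha^2+\beta^2>1$. Put $u=q_1\,j\,\overline{q_2}$ and $v=q_1\,k\,\overline{q_2}$, regarded as vectors in $\mathbb Z^4\subset\mathbb R^4$ by $x+yi+zj+tk\mapsto(x,y,z,t)$. Then: (a) the lattice $\mathbb Z^4\cap(\mathbb R u+\mathbb R v)$ of all integer points in the plane of $u,v$ has covolume (two-dimensional Euclidean area of a fundamental domain) equal to $\operatorname{lcm}(N(q_1),N(q_2))$; (b) the Ehrhart polynomial of the square $\Box$ with vertices $0,u,u+v,v$ is $$E_\Box(t)=\gcd(N(q_1),N(q_2))\,t^2+(D_1+D_2)\,t+1,$$ where $D_1$ and $D_2$ are the greatest common divisors of the four coordinates of $u$ and of $v$, respectively; that is, $\#(t\Box\cap\mathbb Z^4)=E_\Box(t)$ for every $t\in\mathbb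 N$. -/

import Mathlib

open scoped Quaternion Polynomial Pointwise

noncomputable section

namespace LatticeSquare

/-- Four-dimensional Euclidean space. -/
abbrev E4 : Type := EuclideanSpace ℝ (Fin 4)

/-- The integer lattice `ℤ⁴ ⊆ ℝ⁴`. -/
def intLattice : Submodule ℤ E4 where
  carrier := {x | ∀ i, ∃ n : ℤ, x i = n}
  zero_mem' := fun _ => ⟨0, by simp⟩
  add_mem' := by
    intro x y hx hy i
    obtain ⟨m, hm⟩ := hx i
    obtain ⟨n, hn⟩ := hy i
    exact ⟨m + n, by simp [hm, hn]⟩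
  smul_mem' := by
    intro c x hx i
    obtain ⟨m, hm⟩ := hx i
    exact ⟨c * m, by simp [hm]⟩

/-- The integer quaternion `x + yi + zj + tk`. -/
def quat (x y z t : ℤ) : ℍ[ℤ] := ⟨x, y, z, t⟩

/-- The coordinates `(x, y, z, t)` of the integer quaternion `x + yi + zj + tk`. -/
def coords (q : ℍ[ℤ]) : Fin 4 → ℤ := ![q.re, q.imI, q.imJ, q.imK]

/-- The point of `ℝ⁴` that corresponds to an integer quaternion. -/
def toE4 (q : ℍ[ℤ]) : E4 := WithLp.toLp 2 (fun i => (coords q i : ℝ))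

/-- The (nonnegative) greatest common divisor of the four coordinates. -/
def content (q : ℍ[ℤ]) : ℤ := Finset.univ.gcd (coords q)

/-- The norm `N(x + yi + zj + tk) = x² + y² + z² + t²`. -/
def qnorm (q : ℍ[ℤ]) : ℤ := q.re ^ 2 + q.imI ^ 2 + q.imJ ^ 2 + q.imK ^ 2

/-- `q` is not right-divisible by any integer quaternion `α + βi` of absolute value `> 1`. -/
def NoRightFactor (q : ℍ[ℤ]) : Prop :=
  ∀ α β : ℤ, 1 < α ^ 2 + β ^ 2 → ¬ ∃ r : ℍ[ℤ], q = r * quat α β 0 0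

/-- The first side `u = q₁ j q̄₂` of the square. -/
def sideU (q₁ q₂ : ℍ[ℤ]) : ℍ[ℤ] := q₁ * quat 0 0 1 0 * star q₂

/-- The second side `v = q₁ k q̄₂` of the square. -/
def sideV (q₁ q₂ : ℍ[ℤ]) : ℍ[ℤ] := q₁ * quat 0 0 0 1 * star q₂

/-- The (filled) parallelogram with vertices `0, u, u + v, v`. -/
def square (u v : E4) : Set E4 := convexHull ℝ {0, u, u + v, v}

/-- The plane spanned by `u` and `v`. -/
abbrev plane (u v : E4) : Submodule ℝ E4 := Submodule.span ℝ {u, v}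

/-- The integer lattice containing the square: all integer points of its plane, viewed as a
subgroup of the plane. -/
def planeLattice (u v : E4) : Submodule ℤ (plane u v) :=
  intLattice.comap ((plane u v).subtype.restrictScalars ℤ)

/-- `p` is the Ehrhart polynomial of `P`: for all `t ∈ ℕ`, the number of integer points of the
dilate `tP` is `p(t)`. -/
def IsEhrhartPolynomial (P : Set E4) (p : ℚ[X]) : Prop :=
  ∀ t : ℕ, (((t : ℝ) • P) ∩ (intLattice : Set E4)).Finite ∧
    ((((t : ℝ) • P) ∩ (intLattice : Set E4)).ncard : ℚ) = p.eval (t : ℚ)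

end LatticeSquare

end

noncomputable section

namespace LatticeSquare

/-! The `2 × 2` minors of `(u, v)` are governed by `u v̄ = -N(q₂) q₁ i q̄₁` and `ū v = -N(q₁) q₂ i
q̄₂`, whose imaginary parts are, up to sign, the sums and differences of complementary minors
(`sideMinor_add`, `sideMinor_sub`). The absence of right factors `α + βi` makes each vector `q i q̄`
primitive (`NoRightFactor.isUnit_of_dvd_axis`), so the gcd of the minors is `g = gcd(N(q₁), N(q₂))`.

That gcd is the index of `ℤu + ℤv` in the lattice of the plane. In a lattice basis `e`, `f` with `u
= D e`, `v = a e + b f`, the index is `D b` (`IsAdaptedBasis.mul_eq_of_minor`). Since `u ⊥ v` and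
both have squared length `N(q₁) N(q₂)`, the covolume is `N(q₁) N(q₂) / g`, the lcm.

For (b), slice `t□` by the coefficient `n` of `f`: each of the `t b + 1` rows has `t D` points, plus
one when `b ∣ n a`. Summing gives `D b t² + (D + gcd(a, b)) t + 1`, and `D`, `gcd(a, b)` are the
contents of `u` and `v` because the plane lattice is saturated. -/

@[simp] theorem re_quat (x y z t : ℤ) : (quat x y z t).re = x := rfl
@[simp] theorem imI_quat (x y z t : ℤ) : (quat x y z t).imI = y := rfl
@[simp] theorem imJ_quat (x y z t : ℤ) : (quat x y z t).imJ = z := rfl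
@[simp] theorem imK_quat (x y z t : ℤ) : (quat x y z t).imK = t := rfl

/-! ### Primitivity of `q i q̄` -/

/-- The `i`, `j`, `k` coordinates of `q i q̄`. -/
def axis (q : ℍ[ℤ]) : Fin 3 → ℤ :=
  ![q.re ^ 2 + q.imI ^ 2 - q.imJ ^ 2 - q.imK ^ 2, 2 * (q.imI * q.imJ + q.re * q.imK),
    2 * (q.imI * q.imK - q.re * q.imJ)]

/-- Write `q = w + j s` with `w`, `s` Gaussian; the sign in `s` comes from `j i = -k`. A Gaussian
integer divides `q` on the right exactly when it divides both `w` and `s`, so their gcd would be a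
forbidden factor. -/
theorem NoRightFactor.isCoprime {q : ℍ[ℤ]} (hq : NoRightFactor q) (h0 : q ≠ 0) :
    IsCoprime (⟨q.re, q.imI⟩ : GaussianInt) (⟨q.imJ, -q.imK⟩ : GaussianInt) := by
  set w : GaussianInt := ⟨q.re, q.imI⟩ with hw
  set s : GaussianInt := ⟨q.imJ, -q.imK⟩ with hs
  rw [← EuclideanDomain.gcd_isUnit_iff]
  obtain ⟨w', hw'⟩ := EuclideanDomain.gcd_dvd_left w s
  obtain ⟨s', hs'⟩ := EuclideanDomain.gcd_dvd_right w s
  set c := EuclideanDomain.gcd w s with hc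
  rw [Zsqrtd.ext_iff] at hw' hs'
  simp only [hw, hs, Zsqrtd.re_mul, Zsqrtd.im_mul] at hw' hs'
  have hcn : c.norm = c.re ^ 2 + c.im ^ 2 := by rw [Zsqrtd.norm_def]; ring
  by_contra hu
  refine hq c.re c.im ?_ ⟨quat w'.re w'.im s'.re (-s'.im), ?_⟩
  · rw [← hcn]
    have h1 : c.norm ≠ 1 := fun h => hu ((Zsqrtd.norm_eq_one_iff' (by norm_num) c).1 h)
    have h2 : c.norm ≠ 0 := by
      intro h
      rw [hcn] at h
      have h3 : c.re = 0 := by nlinarith [sq_nonneg c.re, sq_nonneg c.im]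
      have h4 : c.im = 0 := by nlinarith [sq_nonneg c.re, sq_nonneg c.im]
      simp only [h3, h4, zero_mul, mul_zero, add_zero] at hw' hs'
      exact h0 (by ext <;> simp [*]; omega)
    have h3 : 0 ≤ c.norm := by rw [hcn]; positivity
    omega
  · ext <;> (simp; linarith [hw'.1, hw'.2, hs'.1, hs'.2])

theorem sum_axis_sq (q : ℍ[ℤ]) : axis q 0 ^ 2 + axis q 1 ^ 2 + axis q 2 ^ 2 = qnorm q ^ 2 := by
  simp [axis, qnorm]; ring

theorem ne_zero_of_odd_qnorm {q : ℍ[ℤ]} (hodd : Odd (qnorm q)) : q ≠ 0 := by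
  rintro rfl
  simp [qnorm] at hodd

theorem qnorm_pos {q : ℍ[ℤ]} (hodd : Odd (qnorm q)) : 0 < qnorm q := by
  have : qnorm q ≠ 0 := by rintro h; simp [h] at hodd
  have : 0 ≤ qnorm q := by unfold qnorm; positivity
  omega

/-- A common divisor of an odd number and of twice an integer divides that integer. -/
theorem dvd_of_dvd_two_mul {d n m : ℤ} (hn : Odd n) (hd : d ∣ n) (h : d ∣ 2 * m) : d ∣ m := by
  have : IsCoprime d 2 := (Int.isCoprime_two_right.2 hn).of_isCoprime_of_dvd_left hd
  exact this.dvd_of_dvd_mul_left h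

/-- The coordinates of `q i q̄` are `|w|² - |s|²` and, up to sign, twice the two parts of `w s̄`. As
`d` divides the odd number `N(q) = |w|² + |s|²`, it divides `|w|²`, `|s|²` and `w s̄`; a Bézout
relation between `w` and `s` then gives `d ∣ w`, `d ∣ s`, hence `d ∣ 1`. -/
theorem NoRightFactor.isUnit_of_dvd_axis {q : ℍ[ℤ]} (hq : NoRightFactor q)
    (hodd : Odd (qnorm q)) {d : ℤ} (hd : ∀ i, d ∣ axis q i) : IsUnit d := by
  have hN : d ∣ qnorm q := by
    rw [← Int.pow_dvd_pow_iff (n := 2) (by norm_num), ← sum_axis_sq]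
    exact dvd_add (dvd_add (pow_dvd_pow_of_dvd (hd 0) 2) (pow_dvd_pow_of_dvd (hd 1) 2))
      (pow_dvd_pow_of_dvd (hd 2) 2)
  obtain ⟨m, n, hmn⟩ := hq.isCoprime (ne_zero_of_odd_qnorm hodd)
  have h0 := hd 0
  have h1 := dvd_of_dvd_two_mul hodd hN (hd 1)
  have h2 := dvd_of_dvd_two_mul hodd hN (hd 2)
  simp only [axis, Matrix.cons_val_zero] at h0
  have h3 : d ∣ q.re ^ 2 + q.imI ^ 2 := dvd_of_dvd_two_mul hodd hN <| by
    rw [show 2 * (q.re ^ 2 + q.imI ^ 2)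
      = qnorm q + (q.re ^ 2 + q.imI ^ 2 - q.imJ ^ 2 - q.imK ^ 2) by simp only [qnorm]; ring]
    exact dvd_add hN h0
  have h4 : d ∣ q.imJ ^ 2 + q.imK ^ 2 := dvd_of_dvd_two_mul hodd hN <| by
    rw [show 2 * (q.imJ ^ 2 + q.imK ^ 2)
      = qnorm q - (q.re ^ 2 + q.imI ^ 2 - q.imJ ^ 2 - q.imK ^ 2) by simp only [qnorm]; ring]
    exact dvd_sub hN h0
  set w : GaussianInt := ⟨q.re, q.imI⟩ with hw
  set s : GaussianInt := ⟨q.imJ, -q.imK⟩ with hs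
  have hww : (d : GaussianInt) ∣ w * star w := by
    rw [Zsqrtd.intCast_dvd]
    exact ⟨by convert h3 using 1; simp [hw]; ring, by simp [hw, mul_comm]⟩
  have hss : (d : GaussianInt) ∣ s * star s := by
    rw [Zsqrtd.intCast_dvd]
    exact ⟨by convert h4 using 1; simp [hs]; ring, by simp [hs, mul_comm]⟩
  have hws : (d : GaussianInt) ∣ w * star s := by
    rw [Zsqrtd.intCast_dvd]
    refine ⟨?_, by convert h1 using 1; simp [hw, hs]; ring⟩
    rw [show (w * star s).re = -(q.imI * q.imK - q.re * q.imJ) by simp [hw, hs]; ring]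
    exact (dvd_neg).2 h2
  have hsw : (d : GaussianInt) ∣ s * star w := by
    obtain ⟨c, hc⟩ := hws
    exact ⟨star c, by rw [← star_star (s * star w)]; simp [hc, mul_comm]⟩
  have hmn' : star m * star w + star n * star s = 1 := by
    have := congrArg star hmn
    simpa [mul_comm] using this
  have hdw : (d : GaussianInt) ∣ w := by
    have : w = star m * (w * star w) + star n * (w * star s) := by
      linear_combination -w * hmn'
    rw [this]
    exact dvd_add (hww.mul_left _) (hws.mul_left _)
  have hds : (d : GaussianInt) ∣ s := by
    have : s = star m * (s * star w) + star n * (s * star s) := by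
      linear_combination -s * hmn'
    rw [this]
    exact dvd_add (hsw.mul_left _) (hss.mul_left _)
  have h : (d : GaussianInt) ∣ ((1 : ℤ) : GaussianInt) := by
    rw [Int.cast_one, ← hmn]
    exact dvd_add (hdw.mul_left _) (hds.mul_left _)
  rw [Zsqrtd.intCast_dvd_intCast] at h
  exact isUnit_of_dvd_one h

theorem NoRightFactor.dvd_of_dvd_mul_axis {q : ℍ[ℤ]} (hq : NoRightFactor q)
    (hodd : Odd (qnorm q)) {d n : ℤ} (hd : ∀ i, d ∣ n * axis q i) : d ∣ n := by
  have h : IsUnit (Finset.univ.gcd (axis q)) :=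
    hq.isUnit_of_dvd_axis hodd fun i => Finset.gcd_dvd (Finset.mem_univ i)
  have h' : d ∣ Finset.univ.gcd fun i => n * axis q i := Finset.dvd_gcd fun i _ => hd i
  rw [Finset.gcd_mul_left] at h'
  exact (dvd_normalize_iff.1 ((h.dvd_mul_right).1 h'))

/-! ### The gcd of the minors of the sides -/

/-- The `2 × 2` minors of a pair of integer vectors. -/
def minor (U V : Fin 4 → ℤ) (i j : Fin 4) : ℤ := U i * V j - U j * V i

/-- The `2 × 2` minors of the pair of sides of the square. -/
def sideMinor (q₁ q₂ : ℍ[ℤ]) : Fin 4 → Fin 4 → ℤ :=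
  minor (coords (sideU q₁ q₂)) (coords (sideV q₁ q₂))

/-- These are the coordinates of `-u v̄ = N(q₂) q₁ i q̄₁`, the self-dual part of `u ∧ v`;
`sideMinor_sub` treats `-ū v` likewise. -/
theorem sideMinor_add (q₁ q₂ : ℍ[ℤ]) :
    sideMinor q₁ q₂ 0 1 + sideMinor q₁ q₂ 2 3
        = qnorm q₂ * axis q₁ 0 ∧
      sideMinor q₁ q₂ 0 2 + sideMinor q₁ q₂ 3 1
        = qnorm q₂ * axis q₁ 1 ∧
      sideMinor q₁ q₂ 0 3 + sideMinor q₁ q₂ 1 2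
        = qnorm q₂ * axis q₁ 2 := by
  refine ⟨?_, ?_, ?_⟩ <;> simp [sideMinor, minor, coords, sideU, sideV, axis, qnorm] <;> ring

theorem sideMinor_sub (q₁ q₂ : ℍ[ℤ]) :
    sideMinor q₁ q₂ 2 3 - sideMinor q₁ q₂ 0 1
        = qnorm q₁ * axis q₂ 0 ∧
      sideMinor q₁ q₂ 3 1 - sideMinor q₁ q₂ 0 2
        = qnorm q₁ * axis q₂ 1 ∧
      sideMinor q₁ q₂ 1 2 - sideMinor q₁ q₂ 0 3
        = qnorm q₁ * axis q₂ 2 := by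
  refine ⟨?_, ?_, ?_⟩ <;> simp [sideMinor, minor, coords, sideU, sideV, axis, qnorm] <;> ring

theorem minor_swap (U V : Fin 4 → ℤ) (i j : Fin 4) : minor U V j i = -minor U V i j := by
  simp only [minor]; ring

theorem minor_self (U V : Fin 4 → ℤ) (i : Fin 4) : minor U V i i = 0 := by
  simp only [minor]; ring

theorem gcd_dvd_sideMinor {q₁ q₂ : ℍ[ℤ]} (hodd : Odd (qnorm q₁)) (i j : Fin 4) :
    (Int.gcd (qnorm q₁) (qnorm q₂) : ℤ) ∣ sideMinor q₁ q₂ i j := by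
  set m := sideMinor q₁ q₂ with hm
  set g : ℤ := ((Int.gcd (qnorm q₁) (qnorm q₂) : ℕ) : ℤ) with hg
  have h1 : g ∣ qnorm q₁ := Int.gcd_dvd_left ..
  have h2 : g ∣ qnorm q₂ := Int.gcd_dvd_right ..
  have key : ∀ {a b r s : ℤ}, a + b = qnorm q₂ * r → b - a = qnorm q₁ * s → g ∣ a ∧ g ∣ b := by
    intro a b r s h h'
    constructor
    · refine dvd_of_dvd_two_mul hodd h1 ?_
      rw [show 2 * a = (a + b) - (b - a) by ring, h, h']
      exact dvd_sub (h2.mul_right _) (h1.mul_right _)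
    · refine dvd_of_dvd_two_mul hodd h1 ?_
      rw [show 2 * b = (a + b) + (b - a) by ring, h, h']
      exact dvd_add (h2.mul_right _) (h1.mul_right _)
  obtain ⟨a0, a1, a2⟩ := sideMinor_add q₁ q₂
  obtain ⟨b0, b1, b2⟩ := sideMinor_sub q₁ q₂
  obtain ⟨h01, h23⟩ := key a0 b0
  obtain ⟨h02, h31⟩ := key a1 b1
  obtain ⟨h03, h12⟩ := key a2 b2
  have sw : ∀ {i j}, g ∣ m i j → g ∣ m j i := fun {i j} h => by
    rw [hm, sideMinor, minor_swap, dvd_neg]; exact h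
  have self : ∀ i, g ∣ m i i := fun i => by rw [hm, sideMinor, minor_self]; exact dvd_zero g
  fin_cases i <;> fin_cases j <;>
    first
    | exact self _
    | assumption
    | exact sw ‹_›

/-- The roles cross: primitivity of `q₂ i q̄₂` extracts `N(q₁)` from the differences, and that of
`q₁ i q̄₁` extracts `N(q₂)` from the sums. -/
theorem dvd_gcd_of_dvd_sideMinor {q₁ q₂ : ℍ[ℤ]} (hodd₁ : Odd (qnorm q₁)) (hodd₂ : Odd (qnorm q₂))
    (hq₁ : NoRightFactor q₁) (hq₂ : NoRightFactor q₂) {d : ℤ}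
    (hd : ∀ i j, d ∣ sideMinor q₁ q₂ i j) :
    d ∣ (Int.gcd (qnorm q₁) (qnorm q₂) : ℤ) := by
  obtain ⟨a0, a1, a2⟩ := sideMinor_add q₁ q₂
  obtain ⟨b0, b1, b2⟩ := sideMinor_sub q₁ q₂
  refine Int.dvd_coe_gcd (hq₂.dvd_of_dvd_mul_axis hodd₂ fun i => ?_)
    (hq₁.dvd_of_dvd_mul_axis hodd₁ fun i => ?_)
  · fin_cases i
    exacts [b0 ▸ dvd_sub (hd _ _) (hd _ _), b1 ▸ dvd_sub (hd _ _) (hd _ _),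
      b2 ▸ dvd_sub (hd _ _) (hd _ _)]
  · fin_cases i
    exacts [a0 ▸ dvd_add (hd _ _) (hd _ _), a1 ▸ dvd_add (hd _ _) (hd _ _),
      a2 ▸ dvd_add (hd _ _) (hd _ _)]

/-! ### Integer points and the lattice of a plane -/

/-- The point of `ℝ⁴` with the given integer coordinates. -/
def intPoint (c : Fin 4 → ℤ) : E4 := WithLp.toLp 2 fun i => (c i : ℝ)

@[simp] theorem intPoint_apply (c : Fin 4 → ℤ) (i : Fin 4) : intPoint c i = c i := rfl

theorem intPoint_add (c d : Fin 4 → ℤ) : intPoint (c + d) = intPoint c + intPoint d := by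
  ext i; simp

theorem intPoint_zsmul (m : ℤ) (c : Fin 4 → ℤ) : intPoint (m • c) = (m : ℝ) • intPoint c := by
  ext i; simp

theorem intPoint_injective : Function.Injective intPoint := by
  intro c d h
  ext i
  have := congrArg (fun x : E4 => x i) h
  simpa using this

theorem mem_intLattice_iff {x : E4} : x ∈ intLattice ↔ ∃ c, intPoint c = x := by
  constructor
  · intro h
    choose c hc using h
    exact ⟨c, by ext i; simp [hc]⟩
  · rintro ⟨c, rfl⟩ i
    exact ⟨c i, rfl⟩

theorem mem_planeLattice_iff {u v : E4} {x : plane u v} :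
    x ∈ planeLattice u v ↔ ∃ c, intPoint c = (x : E4) :=
  mem_intLattice_iff

instance : DiscreteTopology intLattice := by
  have h : intLattice = Submodule.span ℤ
      (Set.range (EuclideanSpace.basisFun (Fin 4) ℝ).toBasis) := by
    ext x
    rw [Module.Basis.mem_span_iff_repr_mem]
    exact forall_congr' fun i => by simp [eq_comm]
  have h' : DiscreteTopology (Submodule.span ℤ
      (Set.range (EuclideanSpace.basisFun (Fin 4) ℝ).toBasis)) := inferInstance
  exact h ▸ h'

instance (u v : E4) : DiscreteTopology (planeLattice u v) :=
  have : DiscreteTopology (intLattice : Set E4) := inferInstanceAs (DiscreteTopology intLattice)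
  DiscreteTopology.preimage_of_continuous_injective (intLattice : Set E4)
    continuous_subtype_val Subtype.val_injective

theorem isZLattice_planeLattice (U V : Fin 4 → ℤ) :
    IsZLattice ℝ (planeLattice (intPoint U) (intPoint V)) := by
  refine ⟨top_le_iff.1 ?_⟩
  rw [← Submodule.span_span_coe_preimage (R := ℝ) (s := {intPoint U, intPoint V})]
  refine Submodule.span_mono fun x hx => ?_
  rw [SetLike.mem_coe, mem_planeLattice_iff]
  rcases hx with hx | hx
  exacts [⟨U, hx.symm⟩, ⟨V, hx.symm⟩]

theorem finrank_plane {u v : E4} (h : LinearIndependent ℝ ![u, v]) :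
    Module.finrank ℝ (plane u v) = 2 := by
  have := finrank_span_eq_card h
  rwa [Matrix.range_cons_cons_empty, Fintype.card_fin] at this

/-! ### Adapted bases and the index of the sublattice -/

/-- `e`, `f` is a basis of the lattice of integer points in the plane of `U` and `V`, in which
`U` and `V` have the upper triangular coordinates `(D, 0)` and `(a, b)`. -/
structure IsAdaptedBasis (U V e f : Fin 4 → ℤ) (D a b : ℤ) : Prop where
  D_pos : 0 < D
  b_pos : 0 < b
  left_eq : U = D • e
  right_eq : V = a • e + b • f
  exists_coords : ∀ c, intPoint c ∈ plane (intPoint U) (intPoint V) →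
    ∃ m n : ℤ, c = m • e + n • f
  indep : LinearIndependent ℝ ![intPoint e, intPoint f]

/-- A Hermite normal form: start from any lattice basis `e₀`, `f₀`, take `e` to be the primitive
vector along `U`, and complete it to a basis. -/
theorem exists_isAdaptedBasis {U V : Fin 4 → ℤ}
    (h : LinearIndependent ℝ ![intPoint U, intPoint V]) :
    ∃ e f D a b, IsAdaptedBasis U V e f D a b := by
  set P := plane (intPoint U) (intPoint V) with hP
  set L := planeLattice (intPoint U) (intPoint V) with hL
  have := isZLattice_planeLattice U V
  have hrank : Module.finrank ℤ L = 2 := by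
    rw [ZLattice.rank ℝ L, finrank_plane h]
  have := ZLattice.module_free ℝ L
  have := ZLattice.module_finite ℝ L
  let B := Module.finBasisOfFinrankEq ℤ L hrank
  obtain ⟨e₀, he₀⟩ := mem_planeLattice_iff.1 (B 0).2
  obtain ⟨f₀, hf₀⟩ := mem_planeLattice_iff.1 (B 1).2
  have hspan : ∀ c, intPoint c ∈ P → ∃ m n : ℤ, c = m • e₀ + n • f₀ := by
    intro c hc
    have hc' : (⟨intPoint c, hc⟩ : P) ∈ L := mem_planeLattice_iff.2 ⟨c, rfl⟩
    refine ⟨B.repr ⟨_, hc'⟩ 0, B.repr ⟨_, hc'⟩ 1, intPoint_injective ?_⟩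
    rw [intPoint_add, intPoint_zsmul, intPoint_zsmul, he₀, hf₀]
    have := congrArg (fun x : L => ((x : P) : E4)) (B.sum_repr ⟨_, hc'⟩)
    rw [Fin.sum_univ_two] at this
    rw [Int.cast_smul_eq_zsmul, Int.cast_smul_eq_zsmul]
    exact this.symm
  obtain ⟨x, y, hU⟩ := hspan U (Submodule.subset_span (by simp))
  obtain ⟨z, w, hV⟩ := hspan V (Submodule.subset_span (by simp))
  rw [LinearIndependent.pair_iff] at h
  have hdet : x * w - y * z ≠ 0 := by
    intro h0
    have h1 : ∀ s t : ℤ, s • U + t • V = 0 → s = 0 ∧ t = 0 := by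
      intro s t hst
      have := h s t (by
        rw [← intPoint_zsmul, ← intPoint_zsmul, ← intPoint_add, hst]; ext i; simp)
      exact_mod_cast this
    have hw := h1 w (-y) (by
      rw [hU, hV]; ext i; simp; linear_combination (e₀ i) * h0)
    have hz := h1 z (-x) (by
      rw [hU, hV]; ext i; simp; linear_combination -(f₀ i) * h0)
    have hU0 : U = 0 := by
      rw [hU, show x = 0 by linarith [hz.2], show y = 0 by linarith [hw.2]]; simp
    have := h1 1 0 (by rw [hU0]; simp)
    simp at this
  have hD : (0 : ℤ) < Int.gcd x y := by
    have : Int.gcd x y ≠ 0 := by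
      intro h0
      rw [Int.gcd_eq_zero_iff] at h0
      simp [h0] at hdet
    omega
  set D : ℤ := ((Int.gcd x y : ℕ) : ℤ) with hDdef
  obtain ⟨x', hx'⟩ : D ∣ x := Int.gcd_dvd_left ..
  obtain ⟨y', hy'⟩ : D ∣ y := Int.gcd_dvd_right ..
  -- The matrix with rows `(x', y')` and `(-r, s)` has determinant 1, so it changes `e₀`, `f₀` into
  -- a new lattice basis.
  obtain ⟨s, r, hsr⟩ : ∃ s r, x' * s + y' * r = 1 := by
    refine ⟨Int.gcdA x y, Int.gcdB x y, mul_left_cancel₀ hD.ne' ?_⟩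
    have := Int.gcd_eq_gcd_ab x y
    rw [← hDdef] at this
    linear_combination -this - (Int.gcdA x y) * hx' - (Int.gcdB x y) * hy'
  have hb : w * x' - z * y' ≠ 0 := by
    intro h0
    apply hdet
    rw [hx', hy']
    linear_combination D * h0
  -- The sign `ε` orients the second basis vector so that `b > 0`.
  obtain ⟨ε, hε, hpos⟩ : ∃ ε : ℤ, ε * ε = 1 ∧ 0 < ε * (w * x' - z * y') := by
    rcases hb.lt_or_gt with hb | hb
    · exact ⟨-1, by norm_num, by linarith⟩
    · exact ⟨1, by norm_num, by linarith⟩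
  have hleft : U = D • (x' • e₀ + y' • f₀) := by
    rw [hU]; ext i; simp; linear_combination (e₀ i) * hx' + (f₀ i) * hy'
  have hright : V = (z * s + w * r) • (x' • e₀ + y' • f₀)
      + (ε * (w * x' - z * y')) • (ε • ((-r) • e₀ + s • f₀)) := by
    rw [hV]; ext i; simp
    linear_combination (-(z * e₀ i) - (w * f₀ i)) * hsr
      - (w * x' - z * y') * (-r * e₀ i + s * f₀ i) * hε
  refine ⟨x' • e₀ + y' • f₀, ε • ((-r) • e₀ + s • f₀), D, z * s + w * r,
    ε * (w * x' - z * y'), hD, hpos, hleft, hright, ?_, ?_⟩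
  · intro c hc
    obtain ⟨m, n, rfl⟩ := hspan c hc
    refine ⟨m * s + n * r, ε * (n * x' - m * y'), ?_⟩
    ext i; simp
    linear_combination (-(m * e₀ i) - (n * f₀ i)) * hsr
      - (n * x' - m * y') * (-r * e₀ i + s * f₀ i) * hε
  · generalize x' • e₀ + y' • f₀ = e at hleft hright
    generalize ε • ((-r) • e₀ + s • f₀) = f at hright
    generalize z * s + w * r = a at hright
    generalize ε * (w * x' - z * y') = b at hright hpos
    have hD' : (D : ℝ) ≠ 0 := by exact_mod_cast hD.ne'
    have hb' : (b : ℝ) ≠ 0 := by exact_mod_cast hpos.ne'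
    rw [LinearIndependent.pair_iff]
    intro m n hmn
    -- The coefficients come from substituting `e = U / D` and `f = (V - a e) / b`.
    have h2 := h (m / D - n * a / (b * D)) (n / b) (by
      rw [hleft, hright, intPoint_add, intPoint_zsmul, intPoint_zsmul, intPoint_zsmul, ← hmn]
      match_scalars <;> field_simp; ring)
    have hn : n = 0 := by simpa [hb'] using h2.2
    have hm := h2.1
    rw [hn] at hm
    exact ⟨by simpa [hD'] using hm, hn⟩

namespace IsAdaptedBasis

variable {U V e f : Fin 4 → ℤ} {D a b : ℤ}

theorem coords_eq_zero (h : IsAdaptedBasis U V e f D a b) {m n : ℤ} (hmn : m • e + n • f = 0) :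
    m = 0 ∧ n = 0 := by
  have := LinearIndependent.pair_iff.1 h.indep m n (by
    rw [← intPoint_zsmul, ← intPoint_zsmul, ← intPoint_add, hmn]; ext i; simp)
  exact_mod_cast this

theorem left_mem_plane (h : IsAdaptedBasis U V e f D a b) :
    intPoint e ∈ plane (intPoint U) (intPoint V) := by
  have hD : (D : ℝ) ≠ 0 := by exact_mod_cast h.D_pos.ne'
  have : intPoint e = (D : ℝ)⁻¹ • intPoint U := by
    rw [h.left_eq, intPoint_zsmul, inv_smul_smul₀ hD]
  rw [this]
  exact Submodule.smul_mem _ _ (Submodule.subset_span (by simp))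

theorem right_mem_plane (h : IsAdaptedBasis U V e f D a b) :
    intPoint f ∈ plane (intPoint U) (intPoint V) := by
  have hb : (b : ℝ) ≠ 0 := by exact_mod_cast h.b_pos.ne'
  have : intPoint f = (b : ℝ)⁻¹ • (intPoint V - (a : ℝ) • intPoint e) := by
    rw [h.right_eq, intPoint_add, intPoint_zsmul, intPoint_zsmul, add_sub_cancel_left,
      inv_smul_smul₀ hb]
  rw [this]
  exact Submodule.smul_mem _ _ (Submodule.sub_mem _ (Submodule.subset_span (by simp))
    (Submodule.smul_mem _ _ h.left_mem_plane))

/-- The lattice of integer points in a plane is saturated in the lattice of all integer points. -/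
theorem dvd_coords (h : IsAdaptedBasis U V e f D a b) {k m n : ℤ}
    (hk : ∀ i, k ∣ (m • e + n • f) i) : k ∣ m ∧ k ∣ n := by
  choose c hc using hk
  have hc' : m • e + n • f = k • c := funext hc
  rcases eq_or_ne k 0 with rfl | hk0
  · obtain ⟨rfl, rfl⟩ := h.coords_eq_zero (by rw [hc', zero_smul])
    simp
  · have hmem : intPoint c ∈ plane (intPoint U) (intPoint V) := by
      have hk : (k : ℝ) ≠ 0 := by exact_mod_cast hk0
      have : intPoint c = (k : ℝ)⁻¹ • ((m : ℝ) • intPoint e + (n : ℝ) • intPoint f) := by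
        rw [← intPoint_zsmul, ← intPoint_zsmul, ← intPoint_add, hc', intPoint_zsmul,
          inv_smul_smul₀ hk]
      rw [this]
      exact Submodule.smul_mem _ _ (Submodule.add_mem _ (Submodule.smul_mem _ _
        h.left_mem_plane) (Submodule.smul_mem _ _ h.right_mem_plane))
    obtain ⟨m', n', rfl⟩ := h.exists_coords c hmem
    have := h.coords_eq_zero (m := m - k * m') (n := n - k * n') (by
      ext i
      have := congrFun hc' i
      simp at this ⊢
      linear_combination this)
    exact ⟨⟨m', by linarith [this.1]⟩, ⟨n', by linarith [this.2]⟩⟩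

theorem gcd_coords_eq (h : IsAdaptedBasis U V e f D a b) (m n : ℤ) :
    Finset.univ.gcd (m • e + n • f) = Int.gcd m n := by
  refine Int.dvd_antisymm ?_ (by positivity) ?_ ?_
  · rw [← Finset.normalize_gcd, ← Int.abs_eq_normalize]
    positivity
  · obtain ⟨h1, h2⟩ := h.dvd_coords (k := Finset.univ.gcd (m • e + n • f))
      fun i => Finset.gcd_dvd (Finset.mem_univ i)
    exact Int.dvd_coe_gcd h1 h2
  · refine Finset.dvd_gcd fun i _ => ?_
    simp only [Pi.add_apply, Pi.smul_apply, smul_eq_mul]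
    exact dvd_add ((Int.gcd_dvd_left ..).mul_right _) ((Int.gcd_dvd_right ..).mul_right _)

theorem gcd_left (h : IsAdaptedBasis U V e f D a b) : Finset.univ.gcd U = D := by
  have := h.gcd_coords_eq D 0
  rw [zero_smul, add_zero, ← h.left_eq, Int.gcd_zero_right] at this
  rw [this, Int.natAbs_of_nonneg h.D_pos.le]

theorem gcd_right (h : IsAdaptedBasis U V e f D a b) : Finset.univ.gcd V = Int.gcd a b := by
  rw [← h.gcd_coords_eq a b, ← h.right_eq]

/-- The vector `e i • f - f i • e` has the minors as coordinates. By saturation a prime dividing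
them all divides each `e i`; saturation applied to `e` itself then makes it divide 1. -/
theorem isUnit_of_dvd_minor (h : IsAdaptedBasis U V e f D a b) {k : ℤ}
    (hk : ∀ i j, k ∣ minor e f i j) : IsUnit k := by
  by_contra hu
  obtain ⟨p, hp, hpk⟩ := Int.exists_prime_and_dvd (n := k) (by rwa [Ne, ← Int.isUnit_iff_natAbs_eq])
  have hdvd : ∀ i, p ∣ e i := fun i => by
    refine (h.dvd_coords (k := p) (m := -f i) (n := e i) fun j => ?_).2
    have : ((-f i) • e + e i • f) j = minor e f i j := by simp [minor]; ring
    rw [this]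
    exact hpk.trans (hk i j)
  exact hp.not_isUnit (isUnit_of_dvd_one
    (h.dvd_coords (k := p) (m := 1) (n := 0) fun j => by simpa using hdvd j).1)

theorem minor_eq (h : IsAdaptedBasis U V e f D a b) (i j : Fin 4) :
    minor U V i j = D * b * minor e f i j := by
  rw [h.left_eq, h.right_eq]
  simp [minor]
  ring

/-- The index of the lattice spanned by `U` and `V` is the greatest common divisor of their
minors. -/
theorem mul_eq_of_minor (h : IsAdaptedBasis U V e f D a b) {g : ℤ} (hg : 0 ≤ g)
    (hdvd : ∀ i j, g ∣ minor U V i j) (hgcd : ∀ d, (∀ i j, d ∣ minor U V i j) → d ∣ g) :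
    D * b = g := by
  have hpos : 0 ≤ D * b := (mul_pos h.D_pos h.b_pos).le
  refine Int.dvd_antisymm hpos hg
    (hgcd _ fun i j => by rw [h.minor_eq]; exact dvd_mul_right ..) ?_
  have hu : IsUnit (Finset.univ.gcd fun x : Fin 4 × Fin 4 => minor e f x.1 x.2) :=
    h.isUnit_of_dvd_minor fun i j =>
      Finset.gcd_dvd (f := fun x : Fin 4 × Fin 4 => minor e f x.1 x.2) (Finset.mem_univ (i, j))
  have : g ∣ Finset.univ.gcd fun x : Fin 4 × Fin 4 => D * b * minor e f x.1 x.2 :=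
    Finset.dvd_gcd fun x _ => by rw [← h.minor_eq]; exact hdvd _ _
  rw [Finset.gcd_mul_left] at this
  exact dvd_normalize_iff.1 (hu.dvd_mul_right.1 this)

end IsAdaptedBasis

/-! ### Covolume of the plane lattice -/

theorem linearIndependent_pair_of_inner_eq_zero {u v : E4} (hu : u ≠ 0) (hv : v ≠ 0)
    (huv : inner ℝ u v = 0) : LinearIndependent ℝ ![u, v] := by
  have hvu : inner ℝ v u = 0 := by rw [real_inner_comm, huv]
  rw [LinearIndependent.pair_iff]
  intro s t hst
  have h1 := congrArg (inner ℝ u) hst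
  have h2 := congrArg (inner ℝ v) hst
  simp only [inner_add_right, real_inner_smul_right, huv, hvu, inner_zero_right,
    real_inner_self_eq_norm_sq] at h1 h2
  constructor
  · simpa [hu] using h1
  · simpa [hv] using h2

/-- The normalized sides form an orthonormal basis of the plane. -/
theorem exists_orthonormalBasis_plane {u v : E4} (hu : u ≠ 0) (hv : v ≠ 0)
    (huv : inner ℝ u v = 0) :
    ∃ o : OrthonormalBasis (Fin 2) ℝ (plane u v),
      (o 0 : E4) = ‖u‖⁻¹ • u ∧ (o 1 : E4) = ‖v‖⁻¹ • v := by
  have hmu : ‖u‖⁻¹ • u ∈ plane u v :=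
    Submodule.smul_mem _ _ (Submodule.subset_span (by simp))
  have hmv : ‖v‖⁻¹ • v ∈ plane u v :=
    Submodule.smul_mem _ _ (Submodule.subset_span (by simp))
  have hvu : inner ℝ v u = 0 := by rw [real_inner_comm, huv]
  have hon : Orthonormal ℝ ![(⟨_, hmu⟩ : plane u v), ⟨_, hmv⟩] := by
    rw [orthonormal_iff_ite]
    intro i j
    fin_cases i <;> fin_cases j <;>
      simp [real_inner_smul_left, real_inner_smul_right, huv, hvu, norm_smul, hu, hv]
  have hsp : ⊤ ≤ Submodule.span ℝ (Set.range ![(⟨_, hmu⟩ : plane u v), ⟨_, hmv⟩]) := by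
    rw [hon.linearIndependent.span_eq_top_of_card_eq_finrank']
    rw [finrank_plane (linearIndependent_pair_of_inner_eq_zero hu hv huv), Fintype.card_fin]
  refine ⟨OrthonormalBasis.mk hon hsp, ?_, ?_⟩ <;> rw [OrthonormalBasis.coe_mk] <;> rfl

-- In the orthonormal frame `U/‖U‖`, `V/‖V‖` the basis `e`, `f` has a triangular matrix, because `V
-- ⊥ e`, with diagonal `‖U‖ / D`, `‖V‖ / b`.
open MeasureTheory Module in
theorem IsAdaptedBasis.covolume_planeLattice {U V e f : Fin 4 → ℤ} {D a b : ℤ}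
    (h : IsAdaptedBasis U V e f D a b) (hU : intPoint U ≠ 0) (hV : intPoint V ≠ 0)
    (horth : inner ℝ (intPoint U) (intPoint V) = 0) :
    ZLattice.covolume (planeLattice (intPoint U) (intPoint V)) volume
      = ‖intPoint U‖ * ‖intPoint V‖ / (D * b) := by
  obtain ⟨o, ho0, ho1⟩ := exists_orthonormalBasis_plane hU hV horth
  have := isZLattice_planeLattice U V
  let e' : planeLattice (intPoint U) (intPoint V) :=
    ⟨⟨intPoint e, h.left_mem_plane⟩, mem_planeLattice_iff.2 ⟨e, rfl⟩⟩
  let f' : planeLattice (intPoint U) (intPoint V) :=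
    ⟨⟨intPoint f, h.right_mem_plane⟩, mem_planeLattice_iff.2 ⟨f, rfl⟩⟩
  have hli : LinearIndependent ℤ ![e', f'] := by
    rw [LinearIndependent.pair_iff]
    intro m n hmn
    refine h.coords_eq_zero (intPoint_injective ?_)
    have := congrArg (fun x : planeLattice (intPoint U) (intPoint V) =>
      ((x : plane (intPoint U) (intPoint V)) : E4)) hmn
    rw [intPoint_add, intPoint_zsmul, intPoint_zsmul, Int.cast_smul_eq_zsmul,
      Int.cast_smul_eq_zsmul, show intPoint 0 = 0 by ext i; simp]
    exact this
  have hsp : ⊤ ≤ Submodule.span ℤ (Set.range ![e', f']) := by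
    rintro x -
    obtain ⟨c, hc⟩ := mem_planeLattice_iff.1 x.2
    obtain ⟨m, n, hmn⟩ := h.exists_coords c (hc ▸ x.1.2)
    rw [Matrix.range_cons_cons_empty, Submodule.mem_span_pair]
    refine ⟨m, n, Subtype.ext (Subtype.ext ?_)⟩
    rw [← hc, hmn, intPoint_add, intPoint_zsmul, intPoint_zsmul, Int.cast_smul_eq_zsmul,
      Int.cast_smul_eq_zsmul]
    rfl
  have hD : (0 : ℝ) < D := by exact_mod_cast h.D_pos
  have hb : (0 : ℝ) < b := by exact_mod_cast h.b_pos
  have hu : intPoint U = (D : ℝ) • intPoint e := by rw [h.left_eq, intPoint_zsmul]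
  have hv : intPoint V = (a : ℝ) • intPoint e + (b : ℝ) • intPoint f := by
    rw [h.right_eq, intPoint_add, intPoint_zsmul, intPoint_zsmul]
  have hue : inner ℝ (intPoint U) (intPoint e) = ‖intPoint U‖ ^ 2 / D := by
    rw [eq_div_iff hD.ne', ← real_inner_self_eq_norm_sq]
    nth_rw 3 [hu]
    rw [real_inner_smul_right, mul_comm]
  have hve : inner ℝ (intPoint V) (intPoint e) = 0 := by
    rw [hu, real_inner_smul_left, real_inner_comm] at horth
    simpa [hD.ne'] using horth
  have hvf : inner ℝ (intPoint V) (intPoint f) = ‖intPoint V‖ ^ 2 / b := by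
    rw [eq_div_iff hb.ne', ← real_inner_self_eq_norm_sq]
    nth_rw 3 [hv]
    rw [inner_add_right, real_inner_smul_right, real_inner_smul_right, hve]
    ring
  have hU' : 0 < ‖intPoint U‖ := norm_pos_iff.2 hU
  have hV' : 0 < ‖intPoint V‖ := norm_pos_iff.2 hV
  rw [ZLattice.covolume_eq_det_mul_measureReal _ volume (Basis.mk hli hsp) o.toBasis,
    measureReal_congr (ZSpan.fundamentalDomain_ae_parallelepiped _ _), OrthonormalBasis.coe_toBasis,
    Measure.real, OrthonormalBasis.volume_parallelepiped, Basis.det_apply, Matrix.det_fin_two]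
  simp only [Basis.toMatrix_apply, OrthonormalBasis.coe_toBasis_repr_apply,
    OrthonormalBasis.repr_apply_apply, Submodule.coe_inner, ho0, ho1, Function.comp_apply,
    Basis.mk_apply, Matrix.cons_val_zero, Matrix.cons_val_one, real_inner_smul_left, e', f',
    hue, hve, hvf]
  rw [mul_zero, mul_zero, sub_zero, ENNReal.toReal_one, mul_one, abs_of_pos (by positivity)]
  field_simp

/-! ### Counting integer points in the dilated square -/

theorem mem_square_iff {u v x : E4} :
    x ∈ square u v ↔ ∃ α ∈ Set.Icc (0 : ℝ) 1, ∃ β ∈ Set.Icc (0 : ℝ) 1, x = α • u + β • v := by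
  have hset : ({0, u, u + v, v} : Set E4) = ∑ i, {(0 : E4), ![u, v] i} := by
    rw [Fin.sum_univ_two]
    ext y
    simp only [Set.mem_add, Set.mem_insert_iff, Set.mem_singleton_iff, Matrix.cons_val_zero,
      Matrix.cons_val_one]
    constructor
    · rintro (rfl | rfl | rfl | rfl)
      exacts [⟨0, .inl rfl, 0, .inl rfl, by simp⟩, ⟨_, .inr rfl, 0, .inl rfl, by simp⟩,
        ⟨_, .inr rfl, _, .inr rfl, rfl⟩, ⟨0, .inl rfl, _, .inr rfl, by simp⟩]
    · rintro ⟨_, rfl | rfl, _, rfl | rfl, rfl⟩ <;> simp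
  rw [square, hset, ← parallelepiped_eq_convexHull, mem_parallelepiped_iff]
  constructor
  · rintro ⟨s, ⟨h0, h1⟩, rfl⟩
    exact ⟨s 0, ⟨h0 0, h1 0⟩, s 1, ⟨h0 1, h1 1⟩, by simp [Fin.sum_univ_two]⟩
  · rintro ⟨α, ⟨hα0, hα1⟩, β, ⟨hβ0, hβ1⟩, rfl⟩
    refine ⟨![α, β], ⟨fun i => ?_, fun i => ?_⟩, by simp [Fin.sum_univ_two]⟩ <;>
      fin_cases i <;> simpa

theorem mem_smul_square_iff {u v x : E4} {t : ℝ} (ht : 0 ≤ t) :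
    x ∈ t • square u v ↔
      ∃ α ∈ Set.Icc (0 : ℝ) t, ∃ β ∈ Set.Icc (0 : ℝ) t, x = α • u + β • v := by
  rw [Set.mem_smul_set]
  constructor
  · rintro ⟨y, hy, rfl⟩
    obtain ⟨α, ⟨hα0, hα1⟩, β, ⟨hβ0, hβ1⟩, rfl⟩ := mem_square_iff.1 hy
    exact ⟨t * α, ⟨by positivity, mul_le_of_le_one_right ht hα1⟩, t * β,
      ⟨by positivity, mul_le_of_le_one_right ht hβ1⟩, by module⟩
  · rintro ⟨α, ⟨hα0, hα1⟩, β, ⟨hβ0, hβ1⟩, rfl⟩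
    -- Rescaling by `1 / t` fails at `t = 0`, where `α = β = 0` is forced.
    rcases ht.eq_or_lt with rfl | ht
    · exact ⟨0, mem_square_iff.2 ⟨0, by simp, 0, by simp, by simp⟩, by
        rw [le_antisymm hα1 hα0, le_antisymm hβ1 hβ0]; simp⟩
    · refine ⟨(α / t) • u + (β / t) • v, mem_square_iff.2 ⟨_, ⟨by positivity, ?_⟩, _,
        ⟨by positivity, ?_⟩, rfl⟩, ?_⟩
      · exact (div_le_one ht).2 hα1
      · exact (div_le_one ht).2 hβ1
      · rw [smul_add, smul_smul, smul_smul, mul_div_cancel₀ _ ht.ne', mul_div_cancel₀ _ ht.ne']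

/-- The coordinates of the integer points of a dilated parallelogram, with respect to a basis in
which the sides are `(D, 0)` and `(a, b)`. -/
def coordsFinset (D a b : ℤ) (t : ℕ) : Finset (Σ _ : ℤ, ℤ) :=
  (Finset.Icc 0 (t * b)).sigma fun n => Finset.Icc (-(-(n * a) / b)) (n * a / b + t * D)

/-- For `b > 0` integer division is the floor, so `-(-(n * a) / b)` is the ceiling of `n a / b`. -/
theorem mem_coordsFinset {D a b : ℤ} (hb : 0 < b) {t : ℕ} {m n : ℤ} :
    ⟨n, m⟩ ∈ coordsFinset D a b t ↔
      (0 ≤ n ∧ n ≤ t * b) ∧ n * a ≤ m * b ∧ m * b ≤ n * a + t * D * b := by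
  rw [coordsFinset, Finset.mem_sigma, Finset.mem_Icc, Finset.mem_Icc, neg_le,
    Int.le_ediv_iff_mul_le hb, ← sub_le_iff_le_add, Int.le_ediv_iff_mul_le hb, sub_mul,
    sub_le_iff_le_add, neg_mul, neg_le_neg_iff]

theorem ediv_add_neg_ediv {b : ℤ} (hb : 0 < b) (x : ℤ) :
    x / b + -x / b = if b ∣ x then 0 else -1 := by
  split_ifs with h
  · obtain ⟨k, rfl⟩ := h
    rw [← mul_neg, Int.mul_ediv_cancel_left _ hb.ne', Int.mul_ediv_cancel_left _ hb.ne']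
    ring
  · have h1 := Int.emod_add_mul_ediv x b
    have h2 := Int.emod_add_mul_ediv (-x) b
    have h3 : 0 < x % b := (Int.emod_nonneg x hb.ne').lt_of_ne fun h0 =>
      h (Int.dvd_of_emod_eq_zero h0.symm)
    have h4 := Int.emod_lt_of_pos x hb
    have h5 := Int.emod_nonneg (-x) hb.ne'
    have h6 := Int.emod_lt_of_pos (-x) hb
    have h7 : b * (x / b + -x / b) < b * 0 := by linarith
    have h8 : b * (-2) < b * (x / b + -x / b) := by linarith
    have := lt_of_mul_lt_mul_left h7 hb.le
    have := lt_of_mul_lt_mul_left h8 hb.le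
    omega

/-- With `g = gcd(a, b)` and `b = g b'`, the condition becomes `b' ∣ n`, and `[0, t g b']` contains
`t g + 1` multiples of `b'`. -/
theorem card_filter_dvd_mul {a b : ℤ} (hb : 0 < b) (t : ℕ) :
    ((Finset.Icc 0 (t * b)).filter fun n => b ∣ n * a).card = t * Int.gcd a b + 1 := by
  have hg : (0 : ℤ) < Int.gcd a b := by
    have : Int.gcd a b ≠ 0 := fun h => hb.ne' (Int.gcd_eq_zero_iff.1 h).2
    omega
  obtain ⟨a', ha⟩ : ((Int.gcd a b : ℕ) : ℤ) ∣ a := Int.gcd_dvd_left ..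
  obtain ⟨b', hb'⟩ : ((Int.gcd a b : ℕ) : ℤ) ∣ b := Int.gcd_dvd_right ..
  have hco : IsCoprime b' a' := by
    refine ⟨Int.gcdB a b, Int.gcdA a b, mul_left_cancel₀ hg.ne' ?_⟩
    linear_combination -(Int.gcd_eq_gcd_ab a b) - (Int.gcdA a b) * ha - (Int.gcdB a b) * hb'
  generalize Int.gcd a b = g at *
  have hb'0 : 0 < b' := by
    rw [hb'] at hb
    exact pos_of_mul_pos_right hb hg.le
  have himg : (Finset.Icc 0 (t * b)).filter (fun n => b ∣ n * a)
      = (Finset.Icc 0 ((t * g : ℕ) : ℤ)).image (fun k => k * b') := by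
    ext n
    have hdvd : b ∣ n * a ↔ b' ∣ n := by
      rw [hb', ha, mul_left_comm, mul_dvd_mul_iff_left hg.ne']
      exact ⟨fun h => hco.dvd_of_dvd_mul_right h, fun h => h.mul_right _⟩
    simp only [Finset.mem_filter, Finset.mem_Icc, Finset.mem_image, hdvd]
    constructor
    · rintro ⟨⟨h0, h1⟩, k, rfl⟩
      refine ⟨k, ⟨(mul_nonneg_iff_of_pos_left hb'0).1 h0, ?_⟩, mul_comm _ _⟩
      push_cast
      refine le_of_mul_le_mul_left ?_ hb'0
      rw [hb'] at h1
      linarith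
    · rintro ⟨k, ⟨h0, h1⟩, rfl⟩
      push_cast at h1
      refine ⟨⟨by positivity, ?_⟩, dvd_mul_left _ _⟩
      rw [hb']
      have := mul_le_mul_of_nonneg_right h1 hb'0.le
      linarith
  rw [himg, Finset.card_image_of_injective _ (mul_left_injective₀ hb'0.ne'), Int.card_Icc]
  omega

theorem card_coordsFinset {D a b : ℤ} (hD : 0 < D) (hb : 0 < b) (t : ℕ) :
    ((coordsFinset D a b t).card : ℤ) = D * b * t ^ 2 + (D + Int.gcd a b) * t + 1 := by
  have hfib : ∀ n : ℤ, ((Finset.Icc (-(-(n * a) / b)) (n * a / b + t * D)).card : ℤ)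
      = t * D + if b ∣ n * a then 1 else 0 := by
    intro n
    have h := ediv_add_neg_ediv hb (n * a)
    -- This keeps the truncation in `Int.card_Icc` harmless: the length is at least 0 even when `b ∤
    -- n a`.
    have : 0 ≤ (t : ℤ) * D := by positivity
    rw [Int.card_Icc]
    split_ifs at h ⊢ <;> omega
  have hcount := card_filter_dvd_mul (a := a) hb t
  rw [coordsFinset, Finset.card_sigma]
  push_cast
  have htb : 0 ≤ (t : ℤ) * b := by positivity
  rw [Finset.sum_congr rfl fun n _ => hfib n, Finset.sum_add_distrib, Finset.sum_const,
    Int.card_Icc, Finset.sum_boole, hcount, nsmul_eq_mul, sub_zero, Int.toNat_of_nonneg (by omega)]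
  push_cast
  ring

theorem IsAdaptedBasis.smul_square_inter_intLattice {U V e f : Fin 4 → ℤ} {D a b : ℤ}
    (h : IsAdaptedBasis U V e f D a b) (t : ℕ) :
    ((t : ℝ) • square (intPoint U) (intPoint V)) ∩ (intLattice : Set E4)
      = (fun x : Σ _ : ℤ, ℤ => intPoint (x.2 • e + x.1 • f)) '' coordsFinset D a b t := by
  have hD : (0 : ℝ) < D := by exact_mod_cast h.D_pos
  have hb : (0 : ℝ) < b := by exact_mod_cast h.b_pos
  have hu : intPoint U = (D : ℝ) • intPoint e := by rw [h.left_eq, intPoint_zsmul]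
  have hv : intPoint V = (a : ℝ) • intPoint e + (b : ℝ) • intPoint f := by
    rw [h.right_eq, intPoint_add, intPoint_zsmul, intPoint_zsmul]
  have hmem : ∀ m n : ℤ, intPoint (m • e + n • f) ∈ (t : ℝ) • square (intPoint U) (intPoint V) ↔
      ⟨n, m⟩ ∈ coordsFinset D a b t := by
    intro m n
    have hreal : ⟨n, m⟩ ∈ coordsFinset D a b t ↔ ((0 : ℝ) ≤ n ∧ (n : ℝ) ≤ t * b) ∧
        (n : ℝ) * a ≤ m * b ∧ (m : ℝ) * b ≤ n * a + t * D * b := by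
      rw [mem_coordsFinset h.b_pos]
      exact_mod_cast Iff.rfl
    rw [hreal, mem_smul_square_iff t.cast_nonneg]
    constructor
    · rintro ⟨α, ⟨hα0, hα1⟩, β, ⟨hβ0, hβ1⟩, hx⟩
      have := LinearIndependent.pair_iff.1 h.indep (m - (α * D + β * a)) (n - β * b) (by
        rw [intPoint_add, intPoint_zsmul, intPoint_zsmul, hu, hv] at hx
        rw [← sub_eq_zero] at hx
        rw [← hx]
        module)
      obtain ⟨hm, hn⟩ := this
      have hm : (m : ℝ) = α * D + β * a := by linarith
      have hn : (n : ℝ) = β * b := by linarith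
      rw [hm, hn]
      have h1 := mul_le_mul_of_nonneg_right hβ1 hb.le
      have h2 : 0 ≤ α * (D * b) := by positivity
      have h3 := mul_le_mul_of_nonneg_right hα1 (mul_pos hD hb).le
      exact ⟨⟨by positivity, h1⟩, by linarith, by linarith⟩
    · rintro ⟨⟨h0, h1⟩, h2, h3⟩
      refine ⟨(m * b - n * a) / (D * b), ⟨div_nonneg (by linarith) (by positivity), ?_⟩,
        n / b, ⟨by positivity, (div_le_iff₀ hb).2 h1⟩, ?_⟩
      · rw [div_le_iff₀ (by positivity)]
        linarith
      · rw [intPoint_add, intPoint_zsmul, intPoint_zsmul, hu, hv]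
        match_scalars <;> field_simp
        ring
  ext x
  constructor
  · rintro ⟨hx, hxL⟩
    obtain ⟨c, rfl⟩ := mem_intLattice_iff.1 hxL
    have hpl : intPoint c ∈ plane (intPoint U) (intPoint V) := by
      obtain ⟨α, -, β, -, hc⟩ := (mem_smul_square_iff t.cast_nonneg).1 hx
      exact Submodule.mem_span_pair.2 ⟨α, β, hc.symm⟩
    obtain ⟨m, n, rfl⟩ := h.exists_coords c hpl
    exact ⟨⟨n, m⟩, (hmem m n).1 hx, rfl⟩
  · rintro ⟨⟨n, m⟩, hx, rfl⟩
    exact ⟨(hmem m n).2 hx, mem_intLattice_iff.2 ⟨_, rfl⟩⟩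

theorem IsAdaptedBasis.isEhrhartPolynomial_square {U V e f : Fin 4 → ℤ} {D a b : ℤ}
    (h : IsAdaptedBasis U V e f D a b) :
    IsEhrhartPolynomial (square (intPoint U) (intPoint V))
      (Polynomial.C ((D * b : ℤ) : ℚ) * Polynomial.X ^ 2
        + Polynomial.C ((D + Int.gcd a b : ℤ) : ℚ) * Polynomial.X + 1) := by
  intro t
  have hinj : Function.Injective
      fun x : Σ _ : ℤ, ℤ => intPoint (x.2 • e + x.1 • f) := by
    rintro ⟨n, m⟩ ⟨n', m'⟩ hx
    have hx' : m • e + n • f = m' • e + n' • f := intPoint_injective hx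
    obtain ⟨h1, h2⟩ := h.coords_eq_zero (m := m - m') (n := n - n') (by
      rw [sub_smul, sub_smul, ← sub_eq_zero.2 hx']; abel)
    rw [sub_eq_zero] at h1 h2
    rw [h1, h2]
  rw [h.smul_square_inter_intLattice]
  refine ⟨(Finset.finite_toSet _).image _, ?_⟩
  rw [Set.ncard_image_of_injective _ hinj, Set.ncard_coe_finset]
  have := card_coordsFinset (a := a) h.D_pos h.b_pos t
  simp only [Polynomial.eval_add, Polynomial.eval_mul, Polynomial.eval_C, Polynomial.eval_pow,
    Polynomial.eval_X, Polynomial.eval_one]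
  exact_mod_cast this

/-! ### Orthogonality and lengths of the sides -/

theorem toE4_eq_intPoint (q : ℍ[ℤ]) : toE4 q = intPoint (coords q) := rfl

theorem inner_intPoint (c d : Fin 4 → ℤ) :
    inner ℝ (intPoint c) (intPoint d) = ((∑ i, c i * d i : ℤ) : ℝ) := by
  simp [PiLp.inner_apply, mul_comm]

theorem inner_sideU_sideV (q₁ q₂ : ℍ[ℤ]) :
    inner ℝ (toE4 (sideU q₁ q₂)) (toE4 (sideV q₁ q₂)) = 0 := by
  rw [toE4_eq_intPoint, toE4_eq_intPoint, inner_intPoint, Int.cast_eq_zero]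
  simp [Fin.sum_univ_four, coords, sideU, sideV]
  ring

theorem norm_toE4_sq (q : ℍ[ℤ]) : ‖toE4 q‖ ^ 2 = qnorm q := by
  rw [← real_inner_self_eq_norm_sq, toE4_eq_intPoint, inner_intPoint]
  simp [Fin.sum_univ_four, coords, qnorm]
  ring

theorem qnorm_sideU (q₁ q₂ : ℍ[ℤ]) : qnorm (sideU q₁ q₂) = qnorm q₁ * qnorm q₂ := by
  simp [qnorm, sideU]; ring

theorem qnorm_sideV (q₁ q₂ : ℍ[ℤ]) : qnorm (sideV q₁ q₂) = qnorm q₁ * qnorm q₂ := by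
  simp [qnorm, sideV]; ring

end LatticeSquare

end

theorem theorem2p12 (q₁ q₂ : ℍ[ℤ])
    (hodd₁ : Odd (LatticeSquare.qnorm q₁)) (hodd₂ : Odd (LatticeSquare.qnorm q₂))
    (hq₁ : LatticeSquare.NoRightFactor q₁) (hq₂ : LatticeSquare.NoRightFactor q₂) :
    ZLattice.covolume
        (LatticeSquare.planeLattice (LatticeSquare.toE4 (LatticeSquare.sideU q₁ q₂))
          (LatticeSquare.toE4 (LatticeSquare.sideV q₁ q₂)))
        MeasureTheory.volume
      = (Int.lcm (LatticeSquare.qnorm q₁) (LatticeSquare.qnorm q₂) : ℝ) ∧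
    LatticeSquare.IsEhrhartPolynomial
      (LatticeSquare.square (LatticeSquare.toE4 (LatticeSquare.sideU q₁ q₂))
        (LatticeSquare.toE4 (LatticeSquare.sideV q₁ q₂)))
      (Polynomial.C (Int.gcd (LatticeSquare.qnorm q₁) (LatticeSquare.qnorm q₂) : ℚ)
          * Polynomial.X ^ 2
        + Polynomial.C ((LatticeSquare.content (LatticeSquare.sideU q₁ q₂)
            + LatticeSquare.content (LatticeSquare.sideV q₁ q₂) : ℤ) : ℚ) * Polynomial.X
        + 1) := by
  open LatticeSquare in
  have hN₁ := qnorm_pos hodd₁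
  have hN₂ := qnorm_pos hodd₂
  have hN : (0 : ℝ) < ((qnorm q₁ * qnorm q₂ : ℤ) : ℝ) := by exact_mod_cast mul_pos hN₁ hN₂
  have hnu := norm_toE4_sq (sideU q₁ q₂)
  have hnv := norm_toE4_sq (sideV q₁ q₂)
  rw [qnorm_sideU] at hnu
  rw [qnorm_sideV] at hnv
  have hu : toE4 (sideU q₁ q₂) ≠ 0 := by
    intro h0
    rw [h0, norm_zero, zero_pow two_ne_zero] at hnu
    exact hN.ne hnu
  have hv : toE4 (sideV q₁ q₂) ≠ 0 := by
    intro h0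
    rw [h0, norm_zero, zero_pow two_ne_zero] at hnv
    exact hN.ne hnv
  have horth := inner_sideU_sideV q₁ q₂
  obtain ⟨e, f, D, a, b, h⟩ := exists_isAdaptedBasis
    (linearIndependent_pair_of_inner_eq_zero hu hv horth)
  have hg := h.mul_eq_of_minor (g := (Int.gcd (qnorm q₁) (qnorm q₂) : ℕ)) (by positivity)
    (gcd_dvd_sideMinor hodd₁) fun d => dvd_gcd_of_dvd_sideMinor hodd₁ hodd₂ hq₁ hq₂
  have hnorm : ‖toE4 (sideU q₁ q₂)‖ * ‖toE4 (sideV q₁ q₂)‖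
      = ((qnorm q₁ * qnorm q₂ : ℤ) : ℝ) := by
    have : ‖toE4 (sideU q₁ q₂)‖ = ‖toE4 (sideV q₁ q₂)‖ :=
      (pow_left_inj₀ (norm_nonneg _) (norm_nonneg _) two_ne_zero).1 (hnu.trans hnv.symm)
    rw [this, ← sq, hnv]
  constructor
  · have hcov := h.covolume_planeLattice hu hv horth
    refine hcov.trans ?_
    rw [← toE4_eq_intPoint, ← toE4_eq_intPoint, hnorm, div_eq_iff (by
      exact_mod_cast (mul_pos h.D_pos h.b_pos).ne')]
    have hlcm : (Int.gcd (qnorm q₁) (qnorm q₂) : ℤ) * Int.lcm (qnorm q₁) (qnorm q₂)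
        = qnorm q₁ * qnorm q₂ := by
      have := Int.gcd_mul_lcm (qnorm q₁) (qnorm q₂)
      rw [← Nat.cast_mul, this, Nat.cast_mul, Int.natCast_natAbs, Int.natCast_natAbs,
        abs_of_pos hN₁, abs_of_pos hN₂]
    rw [← hg] at hlcm
    rw [← hlcm]
    push_cast
    ring
  · have hE := h.isEhrhartPolynomial_square
    rw [hg, ← h.gcd_right, ← h.gcd_left] at hE
    exact_mod_cast hE
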